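/- Let $k$ be an algebraically closed field and let $\mathcal C$ be a $k$-linear, Hom-finite, Krull--Schmidt triangulated category with shift $\Sigma$. Let $r$ and $d$ be integers, let $N$ be an indecomposable object of $\mathcal C$, and suppose that 1. $\mathcal C$ is $d$-Calabi--Yau, that is, $\Sigma^d$ is a Serre functor: there are isomorphisms $\operatorname{Hom}_k(\operatorname{Hom}_{\mathcal C}(X,Y),k)\cong\operatorname{Hom}_{\mathcal C}(Y,\Sigma^dX)$ natural in $X$ and $Y$ (so the Auslander--Reiten translate is $\tau=\Sigma^{-1}\Sigma^{d}$); 2. for every indecomposable object $U$ in the component of $N$ in the Auslander--Reiten quiver of $\mathcal C$, the objects $\Sigma^{r-d}U$ and $U$ lie in the same $\tau$-orbit; 3. every mesh in this component has at most two middle terms, that is, the middle term of an Auslander--Reiten triangle whose third object lies in the component is never a direct sum of more than two indecomposable objects; 4. this component has tree class $A_\infty$, that is, as a translation quiver it is isomorphic to $\mathbb ZA_\infty/G$ for an admissible group $G$ of automorphisms of $\mathbb ZA_\infty$. For a morphism $f:X\to Y$, let the support of $\operatorname{Hom}_{\mathcal C}(-,f)$ be the set of isomorphism classes of indecomposable objects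 $V$ for which there is $\gamma:V\to X$ with $f\gamma\neq0$. Then there is no natural transformation $\alpha:\mathrm{Id}_{\mathcal C}\to\Sigma^r$ in the graded center of $\mathcal C$ (that is, commuting with $\Sigma$ up to the sign $(-1)^r$) such that * for all indecomposable objects $U$ in the component of $N$, the support of $\operatorname{Hom}_{\mathcal C}(-,\alpha_U):\operatorname{Hom}_{\mathcal C}(-,U)\to\operatorname{Hom}_{\mathcal C}(-,\Sigma^rU)$ is finite, and * for some indecomposable object $U$ in the component of $N$ this support has at least two elements. -/

import Mathlib

open CategoryTheory CategoryTheory.Limits CategoryTheory.Pretriangulated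

universe w v u

/-! ### Hypotheses on the category -/

section Hypotheses

/-- Every object is a finite direct sum of objects with local endomorphism rings. -/
def IsKrullSchmidt (C : Type u) [Category.{v} C] [Preadditive C] [HasFiniteBiproducts C] : Prop :=
  ∀ X : C, ∃ (n : ℕ) (E : Fin n → C),
    (∀ i, IsLocalRing (End (E i))) ∧ Nonempty (X ≅ ⨁ E)

variable (k : Type w) [Field k] {C : Type u} [Category.{v} C] [Preadditive C] [Linear k C]

/-- `S` is a Serre functor: a self-equivalence together with isomorphisms
`D Hom(X, Y) ≅ Hom(Y, S X)` which are natural in `X` and in `Y`, where `D = Hom_k(-, k)`. -/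
def IsSerreFunctor (S : C ⥤ C) : Prop :=
  S.IsEquivalence ∧
  ∃ e : ∀ X Y : C, Module.Dual k (X ⟶ Y) ≃ₗ[k] (Y ⟶ S.obj X),
    (∀ (X X' Y : C) (a : X ⟶ X') (φ : Module.Dual k (X ⟶ Y)),
      e X' Y (φ.comp (Linear.leftComp k Y a)) = e X Y φ ≫ S.map a) ∧
    (∀ (X Y Y' : C) (b : Y' ⟶ Y) (φ : Module.Dual k (X ⟶ Y)),
      e X Y' (φ.comp (Linear.rightComp k X b)) = b ≫ e X Y φ)

/-- `C` is `d`-Calabi-Yau: the `d`-th power of the shift is a Serre functor. -/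
def IsCalabiYau (C : Type u) [Category.{v} C] [Preadditive C] [Linear k C] [HasShift C ℤ]
    (d : ℤ) : Prop :=
  IsSerreFunctor k (shiftFunctor C d)

/-- A natural transformation `Id → Σ ^ r` belongs to the graded center (in degree `r`) if it
commutes with the shift up to the sign `(-1) ^ r`; here `Σ (Σ ^ r X)` and `Σ ^ r (Σ X)` are
identified through the canonical isomorphism. -/
def InGradedCenter {C : Type u} [Category.{v} C] [Preadditive C] [HasShift C ℤ]
    {r : ℤ} (α : 𝟭 C ⟶ shiftFunctor C r) : Prop :=
  ∀ X : C, α.app (X⟦(1 : ℤ)⟧) =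
    r.negOnePow • ((α.app X)⟦(1 : ℤ)⟧' ≫ (shiftComm X r 1).hom)

end Hypotheses

/-! ### The radical and the spaces of irreducible morphisms -/

section Radical

variable (k : Type w) [Field k] {C : Type u} [Category.{v} C] [Preadditive C] [Linear k C]

/-- The (Jacobson) radical `Rad(X, Y)`: the morphisms `f : X ⟶ Y` such that `1 - g f` is
invertible for all `g : Y ⟶ X`. -/
def homRad (X Y : C) : Submodule k (X ⟶ Y) where
  carrier := {f | ∀ g : Y ⟶ X, IsIso (𝟙 X - f ≫ g)}
  zero_mem' := by
    intro g
    simp only [zero_comp, sub_zero]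
    infer_instance
  add_mem' := by
    intro a b ha hb g
    have := ha g
    have := hb (g ≫ inv (𝟙 X - a ≫ g))
    have h : 𝟙 X - (a + b) ≫ g
        = (𝟙 X - b ≫ g ≫ inv (𝟙 X - a ≫ g)) ≫ (𝟙 X - a ≫ g) := by
      conv_rhs => rw [Preadditive.sub_comp]
      simp only [Category.id_comp, Category.assoc, IsIso.inv_hom_id, Category.comp_id,
        Preadditive.add_comp]
      abel
    rw [h]
    infer_instance
  smul_mem' := by
    intro c f hf g
    have := hf (c • g)
    simpa using this

/-- The square of the radical: sums of composites of two radical morphisms. -/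
def homRadSq (X Y : C) : Submodule k (X ⟶ Y) :=
  Submodule.span k {h | ∃ (Z : C) (f : X ⟶ Z) (g : Z ⟶ Y),
    f ∈ homRad k X Z ∧ g ∈ homRad k Z Y ∧ h = f ≫ g}

/-- `dim_k Rad(X, Y) / Rad²(X, Y)`. -/
noncomputable def irrDim (X Y : C) : ℕ :=
  Module.finrank k (homRad k X Y ⧸ (homRadSq k X Y).submoduleOf (homRad k X Y))

variable {k}

lemma homRad_conj {X Y X' Y' : C} (e : X ≅ X') (f : Y ≅ Y') {h : X ⟶ Y}
    (hh : h ∈ homRad k X Y) : e.inv ≫ h ≫ f.hom ∈ homRad k X' Y' := by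
  intro g
  have := hh (f.hom ≫ g ≫ e.inv)
  have h' : 𝟙 X' - (e.inv ≫ h ≫ f.hom) ≫ g
      = e.inv ≫ (𝟙 X - h ≫ f.hom ≫ g ≫ e.inv) ≫ e.hom := by
    simp
  rw [h']
  infer_instance

lemma homRadSq_conj {X Y X' Y' : C} (e : X ≅ X') (f : Y ≅ Y') {h : X ⟶ Y}
    (hh : h ∈ homRadSq k X Y) : e.inv ≫ h ≫ f.hom ∈ homRadSq k X' Y' := by
  have key : homRadSq k X Y ≤
      (homRadSq k X' Y').comap (Linear.homCongr k e f).toLinearMap := by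
    refine Submodule.span_le.2 ?_
    rintro _ ⟨Z, a, b, ha, hb, rfl⟩
    refine Submodule.subset_span ⟨Z, e.inv ≫ a, b ≫ f.hom, ?_, ?_, ?_⟩
    · simpa using homRad_conj e (Iso.refl Z) ha
    · simpa using homRad_conj (Iso.refl Z) f hb
    · simp [Linear.homCongr_apply]
  have := key hh
  simpa [Linear.homCongr_apply] using this

lemma irrDim_congr {X Y X' Y' : C} (e : X ≅ X') (f : Y ≅ Y') :
    irrDim k X Y = irrDim k X' Y' := by
  have hmap : (homRad k X Y).map (Linear.homCongr k e f).toLinearMap = homRad k X' Y' := by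
    apply le_antisymm
    · rintro _ ⟨a, ha, rfl⟩
      simpa [Linear.homCongr_apply] using homRad_conj e f ha
    · intro b hb
      refine ⟨e.hom ≫ b ≫ f.inv, by simpa using homRad_conj e.symm f.symm hb, ?_⟩
      simp [Linear.homCongr_apply]
  refine LinearEquiv.finrank_eq (Submodule.Quotient.equiv _ _
    ((Linear.homCongr k e f).ofSubmodules _ _ hmap) ?_)
  apply le_antisymm
  · rintro _ ⟨a, ha, rfl⟩
    have := homRadSq_conj e f (Submodule.mem_comap.1 ha)
    refine Submodule.mem_comap.2 ?_
    simpa [Linear.homCongr_apply] using this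
  · intro b hb
    have hb' := homRadSq_conj e.symm f.symm (Submodule.mem_comap.1 hb)
    refine ⟨⟨e.hom ≫ b.1 ≫ f.inv, by simpa using homRad_conj e.symm f.symm b.2⟩, ?_, ?_⟩
    · refine Submodule.mem_comap.2 ?_
      simpa using hb'
    · apply Subtype.ext
      simp [Linear.homCongr_apply]

end Radical

/-! ### Isomorphism classes of indecomposable objects -/

section IndecClass

variable (C : Type u) [Category.{v} C] [Preadditive C] [HasBinaryBiproducts C]

/-- Isomorphism of indecomposable objects, as a setoid. -/
def indecSetoid : Setoid {X : C // Indecomposable X} where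
  r X Y := Nonempty (X.1 ≅ Y.1)
  iseqv :=
    ⟨fun X => ⟨Iso.refl X.1⟩, fun ⟨e⟩ => ⟨e.symm⟩, fun ⟨e⟩ ⟨f⟩ => ⟨e ≪≫ f⟩⟩

/-- The isomorphism classes of indecomposable objects of `C`. -/
def IndecClass : Type u := Quotient (indecSetoid C)

variable {C}

/-- The isomorphism class of an indecomposable object. -/
def IndecClass.mk (X : C) (hX : Indecomposable X) : IndecClass C :=
  Quotient.mk (indecSetoid C) ⟨X, hX⟩

lemma indecomposable_map_equivalence {X : C} (hX : Indecomposable X) (e : C ≌ C)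
    [e.functor.Additive] : Indecomposable (e.functor.obj X) := by
  have hz : ∀ Y : C, IsZero (e.inverse.obj Y) → IsZero Y := fun Y h =>
    (e.functor.map_isZero h).of_iso (e.counitIso.app Y).symm
  have : PreservesBinaryBiproducts e.inverse :=
    preservesBinaryBiproducts_of_preservesBiproducts e.inverse
  refine ⟨fun h => hX.1 ((e.inverse.map_isZero h).of_iso (e.unitIso.app X)), ?_⟩
  intro Y Z i
  rcases hX.2 (e.inverse.obj Y) (e.inverse.obj Z)
    (e.unitIso.app X ≪≫ e.inverse.mapIso i ≪≫ e.inverse.mapBiprod Y Z) with h | h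
  · exact Or.inl (hz _ h)
  · exact Or.inr (hz _ h)

/-- The permutation of the isomorphism classes of indecomposable objects induced by an
additive self-equivalence, `[X] ↦ [F X]`. -/
noncomputable def IndecClass.perm (F : C ⥤ C) [F.IsEquivalence] [F.Additive] :
    Equiv.Perm (IndecClass C) :=
  have : F.asEquivalence.functor.Additive := ‹F.Additive›
  have : F.asEquivalence.symm.functor.Additive :=
    inferInstanceAs F.asEquivalence.inverse.Additive
  { toFun := Quotient.map' (s₁ := indecSetoid C) (s₂ := indecSetoid C)
      (fun X => ⟨F.obj X.1, indecomposable_map_equivalence X.2 F.asEquivalence⟩)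
      (fun _ _ ⟨e⟩ => ⟨F.mapIso e⟩)
    invFun := Quotient.map' (s₁ := indecSetoid C) (s₂ := indecSetoid C)
      (fun X => ⟨F.inv.obj X.1, indecomposable_map_equivalence X.2 F.asEquivalence.symm⟩)
      (fun _ _ ⟨e⟩ => ⟨F.inv.mapIso e⟩)
    left_inv := by
      rintro ⟨X⟩
      exact Quotient.sound' ⟨(F.asEquivalence.unitIso.app X.1).symm⟩
    right_inv := by
      rintro ⟨X⟩
      exact Quotient.sound' ⟨F.asEquivalence.counitIso.app X.1⟩ }

/-- The support of the natural transformation `Hom(-, f) : Hom(-, X) ⟶ Hom(-, Y)`: the set of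
isomorphism classes of indecomposable objects at which it is nonzero. -/
def homSupport (k : Type w) [Field k] [Linear k C] {X Y : C} (f : X ⟶ Y) :
    Set (IndecClass C) :=
  {c | ∃ (V : C) (hV : Indecomposable V), IndecClass.mk V hV = c ∧
    ((linearYoneda k C).map f).app (Opposite.op V) ≠ 0}

end IndecClass

/-! ### Quivers with translation and tree class `A_∞` -/

/-- A quiver with a translation: a set of vertices, the number of arrows between any two
vertices, and an invertible translation. -/
structure TranslationQuiver where
  /-- vertices -/
  V : Type u
  /-- number of arrows `x → y` -/
  arrows : V → V → ℕ
  /-- the translation -/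
  τ : Equiv.Perm V

namespace TranslationQuiver

/-- The connected component of a vertex, as a set of vertices. -/
def component (Q : TranslationQuiver.{u}) (x : Q.V) : Set Q.V :=
  {y | Relation.EqvGen (fun a b => Q.arrows a b ≠ 0) x y}

/-- The stable translation quiver `ℤB` of a quiver `B` without multiple arrows: for each arrow
`x → y` of `B` and each `n` there are arrows `(n, x) → (n, y)` and `(n, y) → (n + 1, x)`, and
`τ (n, x) = (n - 1, x)`. -/
noncomputable def zQuiver {ι : Type u} (B : ι → ι → Prop) : TranslationQuiver.{u} where
  V := ℤ × ι
  arrows p q := by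
    classical
    exact if (q.1 = p.1 ∧ B p.2 q.2) ∨ (q.1 = p.1 + 1 ∧ B q.2 p.2) then 1 else 0
  τ := (Equiv.subRight (1 : ℤ)).prodCongr (Equiv.refl ι)

/-- `ℤA_∞`, where `A_∞` is oriented as `0 → 1 → 2 → ⋯`. The translation quiver `ℤA_∞` does not
depend on the orientation that is chosen. -/
noncomputable def zAInfinity : TranslationQuiver.{0} :=
  zQuiver (fun i j : ℕ => j = i + 1)

/-- A permutation of the vertices that preserves arrows and commutes with the translation. -/
def IsAutomorphism (Q : TranslationQuiver.{u}) (g : Equiv.Perm Q.V) : Prop :=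
  (∀ x y, Q.arrows (g x) (g y) = Q.arrows x y) ∧ ∀ x, g (Q.τ x) = Q.τ (g x)

/-- A group `G` of automorphisms is admissible if no orbit of `G` meets a set of the form
`{x} ∪ x⁺` or `{x} ∪ x⁻` in more than one vertex, where `x⁺` and `x⁻` are the sets of direct
successors and direct predecessors of `x`. -/
def IsAdmissible (Q : TranslationQuiver.{u}) (G : Subgroup (Equiv.Perm Q.V)) : Prop :=
  (∀ g ∈ G, Q.IsAutomorphism g) ∧
  (∀ x, ∀ g ∈ G, ∀ y ∈ insert x {z | Q.arrows x z ≠ 0},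
    g y ∈ insert x {z | Q.arrows x z ≠ 0} → g y = y) ∧
  (∀ x, ∀ g ∈ G, ∀ y ∈ insert x {z | Q.arrows z x ≠ 0},
    g y ∈ insert x {z | Q.arrows z x ≠ 0} → g y = y)

/-- The set of vertices `K` of `Q`, with the arrows and the translation of `Q`, is isomorphic to
the orbit quiver `Δ/G`. The isomorphism is described by its composite `π` with the projection
from `Δ` onto `Δ/G`: the fibres of `π` are the `G`-orbits, its image is `K`, and it commutes
with the translations; the arrows of `Δ/G` that start at the orbit of `x` are the images of the
arrows of `Δ` that start at `x`, different ones having different images. -/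
def IsIsoToOrbitQuiver (Q : TranslationQuiver.{u}) (K : Set Q.V) (Δ : TranslationQuiver.{v})
    (G : Subgroup (Equiv.Perm Δ.V)) : Prop :=
  ∃ π : Δ.V → Q.V,
    Set.range π = K ∧
    (∀ x y, π x = π y ↔ ∃ g ∈ G, g x = y) ∧
    (∀ x, π (Δ.τ x) = Q.τ (π x)) ∧
    (∀ x y, Δ.arrows x y ≠ 0 → Q.arrows (π x) (π y) = Δ.arrows x y) ∧
    (∀ x, ∀ c ∈ K, Q.arrows (π x) c ≠ 0 → ∃ y, Δ.arrows x y ≠ 0 ∧ π y = c)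

/-- The set of vertices `K` of `Q` has tree class `A_∞`: it is isomorphic to `ℤA_∞/G` for an
admissible group `G` of automorphisms of `ℤA_∞`. -/
def HasTreeClassAInfinity (Q : TranslationQuiver.{u}) (K : Set Q.V) : Prop :=
  ∃ G : Subgroup (Equiv.Perm zAInfinity.V),
    zAInfinity.IsAdmissible G ∧ Q.IsIsoToOrbitQuiver K zAInfinity G

end TranslationQuiver

/-! ### The Auslander-Reiten quiver -/

section ARQuiver

variable (k : Type w) [Field k] {C : Type u} [Category.{v} C] [Preadditive C] [Linear k C]
  [HasShift C ℤ] [∀ n : ℤ, (shiftFunctor C n).Additive]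

/-- The Auslander-Reiten quiver of a category with Serre functor `S`: the vertices are the
isomorphism classes of indecomposable objects, the number of arrows from `[X]` to `[Y]` is
`dim_k Rad(X, Y) / Rad²(X, Y)`, and the translation is `τ = Σ⁻¹ S`. -/
noncomputable def arQuiver [HasBinaryBiproducts C] (S : C ⥤ C) [S.IsEquivalence] [S.Additive] :
    TranslationQuiver.{u} where
  V := IndecClass C
  arrows := Quotient.lift₂ (s₁ := indecSetoid C) (s₂ := indecSetoid C)
    (fun X Y => irrDim k X.1 Y.1)
    (fun _ _ _ _ ⟨e⟩ ⟨f⟩ => irrDim_congr e f)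
  τ := IndecClass.perm (S ⋙ shiftFunctor C (-1 : ℤ))

variable [HasZeroObject C] [Pretriangulated C]

/-- An Auslander-Reiten triangle `X ⟶ Y ⟶ Z ⟶ ΣX`: a distinguished triangle with `X` and `Z`
indecomposable and nonzero third morphism, such that every morphism to `Z` that is not a split
epimorphism factors through `Y ⟶ Z`. -/
structure IsARTriangle (T : Triangle C) : Prop where
  distinguished : T ∈ distTriang C
  indec₁ : Indecomposable T.obj₁
  indec₃ : Indecomposable T.obj₃
  ne_zero : T.mor₃ ≠ 0
  lift : ∀ (W : C) (f : W ⟶ T.obj₃), ¬ IsSplitEpi f → ∃ g : W ⟶ T.obj₂, g ≫ T.mor₂ = f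

/-- Every mesh that ends in `K` has at most two middle terms: the middle term of an
Auslander-Reiten triangle whose third object lies in `K` is never a direct sum of more than two
indecomposable objects. -/
def MeshesHaveAtMostTwoMiddleTerms (K : Set (IndecClass C)) : Prop :=
  ∀ (T : Triangle C) (hT : IsARTriangle T), IndecClass.mk T.obj₃ hT.indec₃ ∈ K →
    ∀ (n : ℕ) (E : Fin n → C), (∀ i, Indecomposable (E i)) →
      Nonempty (T.obj₂ ≅ ⨁ E) → n ≤ 2

end ARQuiver

/-! Write `S = Σ^d`, so that `Σ^r` is `S ∘ Σ^(r-d)`, and call `n` the level of the vertex `(i, n)`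
of `ℤA_∞`. Levels are well defined on the component, and by the orbit hypothesis `Σ^(r-d)` preserves
them. A non-radical morphism between indecomposables is an isomorphism, so it suffices that `α_U`
kills every radical morphism into `U` (`killsRadical_app`): its support then lies in `{U}`.

This is proved by induction on the level of `U`. Radical morphisms into `U` factor through `(a, b) :
A ⊕ B ⟶ U`, with `A` one level below `U` (or zero) and `B` one level above. By induction and Serre
duality `a ≫ α_U = 0` (`comp_app_eq_zero`). If `α_U` does not kill the radical, then `b ≫ α_U ≠ 0`,
while the mesh relation makes it vanish on the irreducible morphism from `τU` to `B`. By Serre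
duality a nonzero `W ⟶ Σ^r U` that kills the radical forces `W ≅ Σ^(r-d) U`
(`eq_zero_of_killsRadical`), which is impossible above the level of `U`. So the argument repeats at
`B` (`exists_mesh`) and climbs forever, contradicting finiteness of the support. -/

/-! ### The radical as an ideal, and irreducible morphisms. -/

section RadicalIdeal

variable {k : Type w} [Field k] {C : Type u} [Category.{v} C] [Preadditive C] [Linear k C]

/-- Jacobson's identity: the inverse of `1 - gf` is `1 + g (1 - fg)⁻¹ f`. It makes the one-sided
definition of the radical symmetric. -/
lemma isIso_one_sub_comp_swap {X Y : C} (f : X ⟶ Y) (g : Y ⟶ X) (h : IsIso (𝟙 X - f ≫ g)) :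
    IsIso (𝟙 Y - g ≫ f) := by
  have h1 : f ≫ g ≫ inv (𝟙 X - f ≫ g) = inv (𝟙 X - f ≫ g) - 𝟙 X := by
    have := IsIso.hom_inv_id (𝟙 X - f ≫ g)
    rw [Preadditive.sub_comp, Category.id_comp, Category.assoc] at this
    exact eq_sub_iff_add_eq'.2 (sub_eq_iff_eq_add.1 this).symm
  have h2 : inv (𝟙 X - f ≫ g) ≫ f ≫ g = inv (𝟙 X - f ≫ g) - 𝟙 X := by
    have := IsIso.inv_hom_id (𝟙 X - f ≫ g)
    rw [Preadditive.comp_sub, Category.comp_id] at this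
    exact eq_sub_iff_add_eq'.2 (sub_eq_iff_eq_add.1 this).symm
  refine ⟨𝟙 Y + g ≫ inv (𝟙 X - f ≫ g) ≫ f, ?_, ?_⟩
  · have : g ≫ f ≫ g ≫ inv (𝟙 X - f ≫ g) ≫ f = g ≫ (f ≫ g ≫ inv (𝟙 X - f ≫ g)) ≫ f := by simp
    simp only [Preadditive.comp_add, Preadditive.sub_comp, Category.comp_id, Category.id_comp,
      Category.assoc]
    rw [this, h1]
    simp only [Preadditive.comp_sub, Preadditive.sub_comp, Category.id_comp]
    abel
  · have : g ≫ inv (𝟙 X - f ≫ g) ≫ f ≫ g ≫ f = g ≫ (inv (𝟙 X - f ≫ g) ≫ f ≫ g) ≫ f := by simp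
    simp only [Preadditive.add_comp, Preadditive.comp_sub, Category.comp_id, Category.id_comp,
      Category.assoc]
    rw [this, h2]
    simp only [Preadditive.comp_sub, Preadditive.sub_comp, Category.id_comp]
    abel

lemma homRad_comp_right {X Y Z : C} {f : X ⟶ Y} (hf : f ∈ homRad k X Y) (h : Y ⟶ Z) :
    f ≫ h ∈ homRad k X Z := by
  intro g
  rw [Category.assoc]
  exact hf _

lemma homRad_comp_left {X Y Z : C} {f : Y ⟶ Z} (hf : f ∈ homRad k Y Z) (h : X ⟶ Y) :
    h ≫ f ∈ homRad k X Z := by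
  intro g
  have := isIso_one_sub_comp_swap (f ≫ g) h (by rw [Category.assoc]; exact hf _)
  rwa [Category.assoc]

lemma comp_mem_homRadSq {X Y Z : C} {f : X ⟶ Y} {g : Y ⟶ Z} (hf : f ∈ homRad k X Y)
    (hg : g ∈ homRad k Y Z) : f ≫ g ∈ homRadSq k X Z :=
  Submodule.subset_span ⟨Y, f, g, hf, hg, rfl⟩

lemma homRadSq_comp_left {X Y Z : C} {f : Y ⟶ Z} (hf : f ∈ homRadSq k Y Z) (h : X ⟶ Y) :
    h ≫ f ∈ homRadSq k X Z := by
  have key : homRadSq k Y Z ≤ (homRadSq k X Z).comap (Linear.leftComp k Z h) := by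
    refine Submodule.span_le.2 ?_
    rintro _ ⟨T, a, b, ha, hb, rfl⟩
    refine Submodule.subset_span ⟨T, h ≫ a, b, homRad_comp_left ha h, hb, ?_⟩
    simp
  exact key hf

lemma homRad_map {D : Type*} [Category* D] [Preadditive D] [Linear k D] (F : C ⥤ D) [F.Full]
    [F.Additive] {X Y : C} {f : X ⟶ Y} (hf : f ∈ homRad k X Y) :
    F.map f ∈ homRad k (F.obj X) (F.obj Y) := by
  intro g
  obtain ⟨g, rfl⟩ := F.map_surjective g
  have := hf g
  have h : 𝟙 (F.obj X) - F.map f ≫ F.map g = F.map (𝟙 X - f ≫ g) := by simp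
  rw [h]
  infer_instance

lemma homRad_of_map {D : Type*} [Category* D] [Preadditive D] [Linear k D] (F : C ⥤ D) [F.Full]
    [F.Faithful] [F.Additive] {X Y : C} {f : X ⟶ Y}
    (hf : F.map f ∈ homRad k (F.obj X) (F.obj Y)) : f ∈ homRad k X Y := by
  intro g
  have := hf (F.map g)
  have h : 𝟙 (F.obj X) - F.map f ≫ F.map g = F.map (𝟙 X - f ≫ g) := by simp
  rw [h] at this
  exact isIso_of_reflects_iso _ F

lemma isIso_of_not_isIso_id_sub {X : C} [IsLocalRing (End X)] {f : X ⟶ X}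
    (h : ¬ IsIso (𝟙 X - f)) : IsIso f := by
  have key : ∀ a : End X, IsUnit a ∨ IsUnit (1 - a) := fun a =>
    IsLocalRing.isUnit_or_isUnit_of_add_one (add_sub_cancel a 1)
  rcases key f with h' | h'
  · exact (isUnit_iff_isIso f).1 h'
  · exact (h ((isUnit_iff_isIso _).1 h')).elim

lemma isSplitMono_of_notMem_homRad {X Y : C} [IsLocalRing (End X)] {f : X ⟶ Y}
    (hf : f ∉ homRad k X Y) : IsSplitMono f := by
  obtain ⟨g, hg⟩ : ∃ g : Y ⟶ X, ¬ IsIso (𝟙 X - f ≫ g) := by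
    by_contra! h
    exact hf h
  have := isIso_of_not_isIso_id_sub hg
  exact ⟨⟨⟨g ≫ inv (f ≫ g), by rw [← Category.assoc, IsIso.hom_inv_id]⟩⟩⟩

lemma isSplitEpi_of_notMem_homRad {X Y : C} [IsLocalRing (End Y)] {f : X ⟶ Y}
    (hf : f ∉ homRad k X Y) : IsSplitEpi f := by
  obtain ⟨g, hg⟩ : ∃ g : Y ⟶ X, ¬ IsIso (𝟙 Y - g ≫ f) := by
    by_contra! h
    exact hf fun g => isIso_one_sub_comp_swap g f (h g)
  have := isIso_of_not_isIso_id_sub hg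
  exact ⟨⟨⟨inv (g ≫ f) ≫ g, by simp⟩⟩⟩

lemma id_notMem_homRad {X : C} (hX : ¬ IsZero X) : 𝟙 X ∉ homRad k X X := by
  intro h
  have h1 := h (𝟙 X)
  rw [Category.comp_id, sub_self] at h1
  exact hX ((IsZero.iff_id_eq_zero X).2 (by
    rw [← IsIso.hom_inv_id (0 : X ⟶ X), zero_comp]))

lemma mem_of_forall_biproduct_component_mem {n : ℕ} {E : Fin n → C} [HasFiniteBiproducts C] {X Y : C}
    (i : X ≅ ⨁ E) (p : Submodule k (X ⟶ Y)) {c : X ⟶ Y}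
    (h : ∀ j, i.hom ≫ biproduct.π E j ≫ biproduct.ι E j ≫ i.inv ≫ c ∈ p) : c ∈ p := by
  have : c = ∑ j, i.hom ≫ biproduct.π E j ≫ biproduct.ι E j ≫ i.inv ≫ c := by
    have h1 : ∑ j, i.hom ≫ biproduct.π E j ≫ biproduct.ι E j ≫ i.inv ≫ c =
        i.hom ≫ (∑ j, biproduct.π E j ≫ biproduct.ι E j) ≫ i.inv ≫ c := by
      simp only [Preadditive.comp_sum, Preadditive.sum_comp, Category.assoc]
    rw [h1, biproduct.total, Category.id_comp, i.hom_inv_id_assoc]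
  rw [this]
  exact p.sum_mem fun j _ => h j

lemma exists_sub_smul_mem_homRadSq {X Y : C} (h : irrDim k X Y = 1) {a c : X ⟶ Y}
    (ha : a ∈ homRad k X Y) (ha' : a ∉ homRadSq k X Y) (hc : c ∈ homRad k X Y) :
    ∃ l : k, c - l • a ∈ homRadSq k X Y := by
  have hne : (Submodule.Quotient.mk ⟨a, ha⟩ :
      homRad k X Y ⧸ (homRadSq k X Y).submoduleOf (homRad k X Y)) ≠ 0 := by
    rw [Ne, Submodule.Quotient.mk_eq_zero]
    exact ha'
  obtain ⟨l, hl⟩ := (finrank_eq_one_iff_of_nonzero' _ hne).1 h (Submodule.Quotient.mk ⟨c, hc⟩)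
  refine ⟨l, ?_⟩
  rw [← Submodule.Quotient.mk_smul, eq_comm, Submodule.Quotient.eq] at hl
  exact hl

variable [∀ X Y : C, Module.Finite k (X ⟶ Y)]

lemma homRad_le_homRadSq {X Y : C} (h : irrDim k X Y = 0) : homRad k X Y ≤ homRadSq k X Y := by
  have := Module.finrank_zero_iff.1 h
  rw [Submodule.Quotient.subsingleton_iff] at this
  exact Submodule.comap_subtype_eq_top.1 this

lemma exists_mem_homRad_notMem_homRadSq {X Y : C} (h : irrDim k X Y ≠ 0) :
    ∃ f ∈ homRad k X Y, f ∉ homRadSq k X Y := by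
  by_contra! H
  refine h (Module.finrank_zero_iff.2 ?_)
  rw [Submodule.Quotient.subsingleton_iff]
  exact Submodule.comap_subtype_eq_top.2 H

end RadicalIdeal

/-! ### Indecomposable objects and local endomorphism rings. -/

section IndecomposableObjects

variable {C : Type u} [Category.{v} C] [Preadditive C] [HasZeroObject C] [HasShift C ℤ]
  [∀ n : ℤ, (shiftFunctor C n).Additive] [Pretriangulated C]

/-- The triangle on a split monomorphism splits, so `X` is the sum of `A` and the cone, and the cone
must vanish. -/
lemma isIso_of_isSplitMono_of_indecomposable {A X : C} (f : A ⟶ X) [IsSplitMono f]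
    (hA : ¬ IsZero A) (hX : Indecomposable X) : IsIso f := by
  obtain ⟨Z, g, h, hT⟩ := distinguished_cocone_triangle f
  have h0 : h = 0 := Triangle.mor₃_eq_zero_of_mono₁ _ hT (inferInstanceAs (Mono f))
  obtain ⟨e, -, -⟩ := exists_iso_binaryBiproduct_of_distTriang _ hT h0
  rcases hX.2 _ _ e with hz | hz
  · exact (hA hz).elim
  · exact (Triangle.isZero₃_iff_isIso₁ _ hT).1 hz

lemma IsKrullSchmidt.isLocalRing_end (hC : IsKrullSchmidt C) {X : C} (hX : Indecomposable X) :
    IsLocalRing (End X) := by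
  obtain ⟨n, E, hE, ⟨i⟩⟩ := hC X
  rcases n with _ | n
  · refine (hX.1 ?_).elim
    rw [IsZero.iff_id_eq_zero, ← cancel_mono i.hom]
    ext j
    exact j.elim0
  · have h0 : ¬ IsZero (E 0) := fun hz => by
      have := hE 0
      exact zero_ne_one (α := End (E 0)) (hz.eq_of_src _ _)
    have hs : IsSplitMono (biproduct.ι E 0 ≫ i.inv) :=
      ⟨⟨⟨i.hom ≫ biproduct.π E 0, by simp⟩⟩⟩
    have := isIso_of_isSplitMono_of_indecomposable (biproduct.ι E 0 ≫ i.inv) h0 hX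
    let j : E 0 ≅ X := asIso (biproduct.ι E 0 ≫ i.inv)
    have := hE 0
    have hadd : ∀ a b : E 0 ⟶ E 0,
        j.inv ≫ (a + b) ≫ j.hom = j.inv ≫ a ≫ j.hom + j.inv ≫ b ≫ j.hom := by simp
    let φ : End (E 0) ≃+* End X := { j.conj with map_add' := hadd }
    have : Nontrivial (End X) := φ.symm.toEquiv.nontrivial
    exact ⟨fun {a b} h => by
      rcases IsLocalRing.isUnit_or_isUnit_of_add_one (a := φ.symm a) (b := φ.symm b)
        (by rw [← map_add, h, map_one]) with h' | h'
      · exact Or.inl (by simpa using h'.map φ)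
      · exact Or.inr (by simpa using h'.map φ)⟩

lemma indecomposable_of_isLocalRing_end {X : C} (hX : IsLocalRing (End X)) :
    Indecomposable X := by
  have hz : ∀ {A B : C} (_ : X ≅ A ⊞ B) (i : A ⟶ X) (p : X ⟶ A) (j : B ⟶ X) (q : X ⟶ B),
      i ≫ p = 𝟙 A → j ≫ p = 0 → j ≫ q = 𝟙 B → IsIso (p ≫ i) → IsZero B := by
    intro A B _ i p j q hip hjp hjq _
    rw [IsZero.iff_id_eq_zero, ← hjq]
    have : j = 0 := by
      rw [← cancel_mono (p ≫ i), reassoc_of% hjp, zero_comp, zero_comp]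
    rw [this, zero_comp]
  refine ⟨fun h => zero_ne_one (α := End X) (h.eq_of_src _ _), fun A B e => ?_⟩
  have hsum : (e.hom ≫ biprod.fst) ≫ biprod.inl ≫ e.inv +
      (e.hom ≫ biprod.snd) ≫ biprod.inr ≫ e.inv = 𝟙 X := by
    have h : e.hom ≫ (biprod.fst ≫ biprod.inl + biprod.snd ≫ biprod.inr) ≫ e.inv = 𝟙 X := by
      rw [biprod.total, Category.id_comp, e.hom_inv_id]
    simpa only [Preadditive.add_comp, Preadditive.comp_add, Category.assoc] using h
  rcases IsLocalRing.isUnit_or_isUnit_of_add_one (R := End X) hsum with h | h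
  · exact Or.inr (hz e (biprod.inl ≫ e.inv) (e.hom ≫ biprod.fst) (biprod.inr ≫ e.inv)
      (e.hom ≫ biprod.snd) (by simp) (by simp) (by simp) ((isUnit_iff_isIso _).1 h))
  · exact Or.inl (hz (e ≪≫ biprod.braiding A B) (biprod.inr ≫ e.inv) (e.hom ≫ biprod.snd)
      (biprod.inl ≫ e.inv) (e.hom ≫ biprod.fst) (by simp) (by simp) (by simp)
      ((isUnit_iff_isIso _).1 h))

variable {k : Type w} [Field k] [Linear k C]

lemma IsKrullSchmidt.nonempty_iso_of_notMem_homRad (hC : IsKrullSchmidt C) {X Y : C}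
    (hX : Indecomposable X) (hY : Indecomposable Y) {f : X ⟶ Y} (hf : f ∉ homRad k X Y) :
    Nonempty (X ≅ Y) := by
  have := hC.isLocalRing_end hX
  have := isSplitMono_of_notMem_homRad hf
  have := isIso_of_isSplitMono_of_indecomposable f hX.1 hY
  exact ⟨asIso f⟩

/-- A morphism is the sum of its restrictions to the indecomposable summands of its source, so
containment of the radical in a family stable under precomposition may be tested on indecomposable
sources. -/
lemma IsKrullSchmidt.induction_sources (hC : IsKrullSchmidt C) {E W : C}
    (p : ∀ Y : C, Submodule k (Y ⟶ W)) (hp : ∀ {Y Z : C} (g : Y ⟶ Z) {c}, c ∈ p Z → g ≫ c ∈ p Y)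
    (h : ∀ Y, Indecomposable Y → homRad k Y W ≤ p Y) : homRad k E W ≤ p E := by
  intro c hc
  obtain ⟨n, F, hF, ⟨i⟩⟩ := hC E
  refine mem_of_forall_biproduct_component_mem i (p E) fun j => ?_
  rw [← Category.assoc]
  exact hp _ (h _ (indecomposable_of_isLocalRing_end (hF j))
    (homRad_comp_left (homRad_comp_left hc _) _))

end IndecomposableObjects

/-! ### Serre duality and morphisms killing the radical. -/

section Serre

variable {k : Type w} [Field k] {C : Type u} [Category.{v} C] [Preadditive C] [Linear k C]

/-- A morphism `f` that vanishes on all radical morphisms into its source. -/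
def KillsRadical (k : Type w) [Field k] [Linear k C] {W Z : C} (f : W ⟶ Z) : Prop :=
  ∀ (Y : C) (b : Y ⟶ W), b ∈ homRad k Y W → b ≫ f = 0

lemma KillsRadical.comp {W Z Z' : C} {f : W ⟶ Z} (hf : KillsRadical k f) (g : Z ⟶ Z') :
    KillsRadical k (f ≫ g) := fun Y b hb => by
  rw [← Category.assoc, hf Y b hb, zero_comp]

/-- If `f` corresponds to the functional `φ` on `Hom(X, W)`, then killing the radical means that `φ`
vanishes on radical morphisms: naturality, evaluated at `𝟙 X`. The composite corresponds to `g ↦ φ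
(a ≫ g)`, and `a ≫ g` is radical. -/
lemma IsSerreFunctor.comp_map_eq_zero {S : C ⥤ C} (hS : IsSerreFunctor k S) {W X X' : C}
    {f : W ⟶ S.obj X} (hf : KillsRadical k f) {a : X ⟶ X'} (ha : a ∈ homRad k X X') :
    f ≫ S.map a = 0 := by
  obtain ⟨-, e, h₁, h₂⟩ := hS
  obtain ⟨φ, rfl⟩ := (e X W).surjective f
  rw [← h₁, LinearEquiv.map_eq_zero_iff]
  ext g
  have h := hf X (a ≫ g) (homRad_comp_right ha g)
  rw [← h₂, LinearEquiv.map_eq_zero_iff] at h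
  simpa using LinearMap.congr_fun h (𝟙 X)

lemma IsSerreFunctor.exists_notMem_homRad {S : C ⥤ C} (hS : IsSerreFunctor k S) {W X : C}
    {f : W ⟶ S.obj X} (hf : KillsRadical k f) (hf₀ : f ≠ 0) : ∃ g : X ⟶ W, g ∉ homRad k X W := by
  obtain ⟨-, e, h₁, h₂⟩ := hS
  obtain ⟨φ, rfl⟩ := (e X W).surjective f
  by_contra! H
  refine hf₀ ?_
  rw [LinearEquiv.map_eq_zero_iff]
  ext g
  have h := hf X g (H g)
  rw [← h₂, LinearEquiv.map_eq_zero_iff] at h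
  simpa using LinearMap.congr_fun h (𝟙 X)

/-- Take the Serre dual of a nonzero functional on `End W` that vanishes on the radical. This is the
connecting morphism of the Auslander-Reiten triangle. -/
lemma IsSerreFunctor.exists_killsRadical {S : C ⥤ C} (hS : IsSerreFunctor k S) {W : C}
    (hW : ¬ IsZero W) : ∃ δ : W ⟶ S.obj W, δ ≠ 0 ∧ KillsRadical k δ := by
  obtain ⟨-, e, h₁, h₂⟩ := hS
  obtain ⟨φ, hφ, hle⟩ := Submodule.exists_le_ker_of_lt_top (homRad k W W)
    (lt_top_iff_ne_top.2 fun h => id_notMem_homRad (k := k) hW (h ▸ Submodule.mem_top))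
  refine ⟨e W W φ, by simpa using hφ, fun Y b hb => ?_⟩
  rw [← h₂, LinearEquiv.map_eq_zero_iff]
  ext g
  exact hle (homRad_comp_left hb g)

end Serre

/-! ### Existence of Auslander-Reiten triangles. -/

section AlmostSplit

variable {k : Type w} [Field k] {C : Type u} [Category.{v} C] [Preadditive C] [Linear k C]
  [HasZeroObject C] [HasShift C ℤ] [∀ n : ℤ, (shiftFunctor C n).Additive] [Pretriangulated C]

/-- The first two morphisms `X ⟶ E ⟶ W` of an Auslander-Reiten triangle, with the properties
expressed in terms of the radical. -/
structure IsAlmostSplit (k : Type w) [Field k] [Linear k C] {X E W : C} (x : X ⟶ E) (e : E ⟶ W) :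
    Prop where
  zero : x ≫ e = 0
  mem_homRad : e ∈ homRad k E W
  lift : ∀ {Y : C} {c : Y ⟶ W}, c ∈ homRad k Y W → ∃ t, c = t ≫ e
  desc : ∀ {Z : C} {u : X ⟶ Z}, u ∈ homRad k X Z → ∃ t, u = x ≫ t
  exact : ∀ {Z : C} {t : E ⟶ Z}, x ≫ t = 0 → ∃ s, t = e ≫ s

lemma IsSerreFunctor.exists_isAlmostSplit (hC : IsKrullSchmidt C) {S : C ⥤ C} [S.Additive]
    (hS : IsSerreFunctor k S) {W : C} (hW : Indecomposable W) :
    ∃ (E : C) (x : (S.obj W)⟦(-1 : ℤ)⟧ ⟶ E) (e : E ⟶ W), IsAlmostSplit k x e := by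
  obtain ⟨δ, hδ₀, hδ⟩ := hS.exists_killsRadical hW.1
  have := hS.1
  let i : S.obj W ≅ ((S.obj W)⟦(-1 : ℤ)⟧)⟦(1 : ℤ)⟧ :=
    ((shiftFunctorCompIsoId C (-1 : ℤ) 1 (by simp)).app (S.obj W)).symm
  obtain ⟨E, x, e, hT⟩ := distinguished_cocone_triangle₂ (δ ≫ i.hom)
  refine ⟨E, x, e, comp_distTriang_mor_zero₁₂ _ hT, ?_, fun {Y c} hc => ?_, fun {Z u} hu => ?_,
    fun {Z t} ht => Triangle.yoneda_exact₂ _ hT t ht⟩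
  -- A split epimorphism `e` would make the third morphism of the triangle zero, hence also `δ`.
  · by_contra H
    have := hC.isLocalRing_end hW
    have := isSplitEpi_of_notMem_homRad H
    have h0 : δ ≫ i.hom = 0 := Triangle.mor₃_eq_zero_of_epi₂ _ hT (inferInstanceAs (Epi e))
    exact hδ₀ (by rwa [Preadditive.IsIso.comp_right_eq_zero] at h0)
  · exact Triangle.coyoneda_exact₃ _ hT c (hδ.comp i.hom Y c hc)
  -- Since `S` is full and essentially surjective, `Σu` is, up to isomorphism, `S` of a radical
  -- morphism, and `δ` composed with such a morphism is zero. Exactness of the rotated triangle then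
  -- extends `u` along `x`.
  · let j : S.obj (S.objPreimage (Z⟦(1 : ℤ)⟧)) ≅ Z⟦(1 : ℤ)⟧ := S.objObjPreimageIso _
    have hu' : S.preimage (i.hom ≫ u⟦(1 : ℤ)⟧' ≫ j.inv) ∈ homRad k _ _ := by
      refine homRad_of_map S ?_
      rw [S.map_preimage]
      exact homRad_comp_left (homRad_comp_right (homRad_map (shiftFunctor C (1 : ℤ)) hu) _) _
    have h0 := hS.comp_map_eq_zero hδ hu'
    rw [S.map_preimage] at h0
    have h1 : (δ ≫ i.hom) ≫ u⟦(1 : ℤ)⟧' = 0 := by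
      rw [← cancel_mono j.inv]
      simpa using h0
    obtain ⟨g, hg⟩ : ∃ g : E⟦(1 : ℤ)⟧ ⟶ Z⟦(1 : ℤ)⟧, u⟦(1 : ℤ)⟧' = (-x⟦(1 : ℤ)⟧') ≫ g :=
      Triangle.yoneda_exact₂ _ (rot_of_distTriang _ (rot_of_distTriang _ hT)) (u⟦(1 : ℤ)⟧') h1
    obtain ⟨g, rfl⟩ := (shiftFunctor C (1 : ℤ)).map_surjective g
    -- The sign cancels the one that rotation puts on `Σx`.
    refine ⟨-g, (shiftFunctor C (1 : ℤ)).map_injective ?_⟩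
    rw [hg]
    simp

end AlmostSplit

/-! ### Mesh relations. -/

section Mesh

variable {k : Type w} [Field k] {C : Type u} [Category.{v} C] [Preadditive C] [Linear k C]

lemma IsAlmostSplit.homRadSq_le_map_rightComp {X E W : C} {x : X ⟶ E} {e : E ⟶ W}
    (h : IsAlmostSplit k x e) (Y : C) :
    homRadSq k Y W ≤ (homRad k Y E).map (Linear.rightComp k Y e) := by
  refine Submodule.span_le.2 ?_
  rintro _ ⟨Z, f, g, hf, hg, rfl⟩
  obtain ⟨t, rfl⟩ := h.lift hg
  exact ⟨f ≫ t, homRad_comp_right hf t, by simp⟩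

lemma IsAlmostSplit.homRadSq_le_map_leftComp {X E W : C} {x : X ⟶ E} {e : E ⟶ W}
    (h : IsAlmostSplit k x e) (Z : C) :
    homRadSq k X Z ≤ (homRad k E Z).map (Linear.leftComp k Z x) := by
  refine Submodule.span_le.2 ?_
  rintro _ ⟨Y, f, g, hf, hg, rfl⟩
  obtain ⟨t, rfl⟩ := h.desc hf
  exact ⟨t ≫ g, homRad_comp_left hg t, by simp⟩

/-- The morphisms `Y ⟶ W` that factor through `(a, b) : A ⊕ B ⟶ W` up to the square of the
radical. -/
def factorsModRadSq (k : Type w) [Field k] [Linear k C] {A B W : C} (a : A ⟶ W) (b : B ⟶ W)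
    (Y : C) : Submodule k (Y ⟶ W) :=
  LinearMap.range (Linear.rightComp k Y a) ⊔ LinearMap.range (Linear.rightComp k Y b) ⊔
    homRadSq k Y W

lemma mem_factorsModRadSq {A B W : C} {a : A ⟶ W} {b : B ⟶ W} {Y : C} {c : Y ⟶ W} :
    c ∈ factorsModRadSq k a b Y ↔
      ∃ (u : Y ⟶ A) (v : Y ⟶ B), ∃ q ∈ homRadSq k Y W, u ≫ a + v ≫ b + q = c := by
  simp only [factorsModRadSq, Submodule.mem_sup, LinearMap.mem_range]
  constructor
  · rintro ⟨_, ⟨_, ⟨u, rfl⟩, _, ⟨v, rfl⟩, rfl⟩, q, hq, rfl⟩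
    exact ⟨u, v, q, hq, rfl⟩
  · rintro ⟨u, v, q, hq, rfl⟩
    exact ⟨_, ⟨_, ⟨u, rfl⟩, _, ⟨v, rfl⟩, rfl⟩, q, hq, rfl⟩

lemma comp_mem_factorsModRadSq {A B W : C} {a : A ⟶ W} {b : B ⟶ W} {Y Z : C} (g : Y ⟶ Z)
    {c : Z ⟶ W} (hc : c ∈ factorsModRadSq k a b Z) : g ≫ c ∈ factorsModRadSq k a b Y := by
  obtain ⟨u, v, q, hq, rfl⟩ := mem_factorsModRadSq.1 hc
  exact mem_factorsModRadSq.2 ⟨g ≫ u, g ≫ v, g ≫ q, homRadSq_comp_left hq g, by simp⟩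

/-- If radical morphisms into `W` factor through `(a, b)` modulo the square of the radical, then
so do they exactly, and the kernel of `(a, b)` contains an irreducible component. -/
lemma IsAlmostSplit.exists_mesh {X E W A B : C} {x : X ⟶ E} {e : E ⟶ W}
    (h : IsAlmostSplit k x e) {a : A ⟶ W} {b : B ⟶ W} (ha : a ∈ homRad k A W)
    (hb : b ∈ homRad k B W) (hb' : b ∉ homRadSq k B W) (hBA : ∀ g : B ⟶ A, g ∈ homRad k B A)
    (he : e ∈ factorsModRadSq k a b E) :
    (∀ (Y : C) (c : Y ⟶ W), c ∈ homRad k Y W → ∃ u v, c = u ≫ a + v ≫ b) ∧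
      ∃ (a₁ : X ⟶ A) (b₁ : X ⟶ B), a₁ ≫ a + b₁ ≫ b = 0 ∧ b₁ ∉ homRadSq k X B := by
  obtain ⟨m₁, m₂, hm⟩ : ∃ m₁ m₂, e = m₁ ≫ a + m₂ ≫ b := by
    obtain ⟨u, v, q, hq, huv⟩ := mem_factorsModRadSq.1 he
    obtain ⟨ρ, hρ, rfl⟩ := h.homRadSq_le_map_rightComp E hq
    -- A Nakayama argument: the error term is `ρ ≫ e` with `ρ` radical, so it is absorbed by
    -- inverting `1 - ρ`.
    have hinv := hρ (𝟙 E)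
    rw [Category.comp_id] at hinv
    have h1 : (𝟙 E - ρ) ≫ e = u ≫ a + v ≫ b := by
      rw [Preadditive.sub_comp, Category.id_comp, sub_eq_iff_eq_add]
      exact huv.symm
    refine ⟨inv (𝟙 E - ρ) ≫ u, inv (𝟙 E - ρ) ≫ v, ?_⟩
    rw [← cancel_epi (𝟙 E - ρ), h1]
    simp only [Preadditive.comp_add, Category.assoc, IsIso.hom_inv_id_assoc]
  refine ⟨fun Y c hc => ?_, x ≫ m₁, x ≫ m₂, ?_, fun hrad => hb' ?_⟩
  · obtain ⟨t, rfl⟩ := h.lift hc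
    exact ⟨t ≫ m₁, t ≫ m₂, by simp [hm]⟩
  · rw [Category.assoc, Category.assoc, ← Preadditive.comp_add, ← hm, h.zero]
  -- If `x ≫ m₂` were in the square of the radical, `m₂` would be a radical morphism plus one
  -- factoring through `e`. With `b = l ≫ e`, this makes `l ≫ m₂` radical, and `b = (l ≫ m₁) ≫ a +
  -- (l ≫ m₂) ≫ b` would not be irreducible.
  · obtain ⟨t, ht, hxt⟩ := h.homRadSq_le_map_leftComp B hrad
    have h0 : x ≫ (m₂ - t) = 0 := by
      rw [Preadditive.comp_sub, sub_eq_zero]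
      exact hxt.symm
    obtain ⟨s, hs⟩ := h.exact h0
    obtain ⟨l, hl⟩ := h.lift hb
    have hlm : l ≫ m₂ = l ≫ t + b ≫ s := by
      rw [sub_eq_iff_eq_add'.1 hs, Preadditive.comp_add, ← Category.assoc l e, ← hl]
    have hbb : b = (l ≫ m₁) ≫ a + (l ≫ m₂) ≫ b := by
      conv_lhs => rw [hl, hm]
      simp
    rw [hbb]
    refine add_mem (comp_mem_homRadSq (hBA _) ha) (comp_mem_homRadSq ?_ hb)
    rw [hlm]
    exact add_mem (homRad_comp_left ht l) (homRad_comp_right hb s)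

end Mesh

/-! ### Levels in `ℤA_∞` and its orbit quivers. -/

namespace TranslationQuiver

/-- Adjacency in `ℤA_∞`. -/
def ZAInfinityAdj (p q : ℤ × ℕ) : Prop :=
  (q.1 = p.1 ∧ q.2 = p.2 + 1) ∨ (q.1 = p.1 + 1 ∧ p.2 = q.2 + 1)

lemma zAInfinity_arrows_ne_zero (p q : ℤ × ℕ) : zAInfinity.arrows p q ≠ 0 ↔ ZAInfinityAdj p q := by
  simp only [zAInfinity, zQuiver, ZAInfinityAdj, ne_eq, ite_eq_right_iff, one_ne_zero, imp_false,
    not_not]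

lemma zAInfinity_arrows_eq_one {p q : ℤ × ℕ} (h : ZAInfinityAdj p q) :
    zAInfinity.arrows p q = 1 :=
  if_pos h

/-- Automorphisms of `ℤA_∞` preserve the level. Level `0` is characterised by having a single direct
successor; the higher levels follow by induction along the arrows. -/
lemma snd_apply_of_zAInfinityAdj_iff (n : ℕ) : ∀ (g : Equiv.Perm (ℤ × ℕ)),
    (∀ p q, ZAInfinityAdj (g p) (g q) ↔ ZAInfinityAdj p q) → ∀ i : ℤ, (g (i, n)).2 = n := by
  induction n using Nat.strong_induction_on with
  | _ n ih =>
  intro g hg i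
  have hsymm : ∀ p q, ZAInfinityAdj (g.symm p) (g.symm q) ↔ ZAInfinityAdj p q := fun p q => by
    rw [← hg, Equiv.apply_symm_apply, Equiv.apply_symm_apply]
  rcases n with _ | n
  · obtain ⟨⟨j, m⟩, hm⟩ : ∃ p, g (i, 0) = p := ⟨_, rfl⟩
    rw [hm]
    rcases m with _ | m
    · rfl
    · exfalso
      have succ : ∀ q, ZAInfinityAdj (j, m + 1) q → g.symm q = (i, 1) := fun q hq => by
        have h1 := (hsymm _ _).2 hq
        rw [← hm, Equiv.symm_apply_apply] at h1
        rcases h1 with h1 | h1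
        · exact Prod.ext h1.1 h1.2
        · exact absurd h1.2 (by simp)
      have h1 := succ (j, m + 2) (Or.inl ⟨rfl, rfl⟩)
      have h2 := succ (j + 1, m) (Or.inr ⟨rfl, rfl⟩)
      have h3 := congrArg Prod.snd (g.symm.injective (h1.trans h2.symm))
      simp at h3
  · have h1 : ZAInfinityAdj (g (i, n)) (g (i, n + 1)) := (hg _ _).2 (Or.inl ⟨rfl, rfl⟩)
    rw [ZAInfinityAdj, ih n (by omega) g hg i] at h1
    rcases h1 with h1 | h1
    · exact h1.2
    -- Otherwise the image lies on level `n - 1`, which `g.symm` preserves by induction, although it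
    -- sends the image back to level `n + 1`.
    · exfalso
      have h2 := ih (n - 1) (by omega) g.symm hsymm ((g (i, n)).1 + 1)
      have h3 : g (i, n + 1) = ((g (i, n)).1 + 1, n - 1) := Prod.ext h1.1 (by simp; omega)
      rw [← h3, Equiv.symm_apply_apply] at h2
      simp at h2
      omega

/-- A covering of `K` by `ℤA_∞`, with the properties that survive forgetting the group. -/
structure IsZAInfinityCover (Q : TranslationQuiver.{u}) (K : Set Q.V) (π : ℤ × ℕ → Q.V) :
    Prop where
  mem_iff : ∀ c, c ∈ K ↔ ∃ p, π p = c
  level : ∀ {p q}, π p = π q → p.2 = q.2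
  map_τ : ∀ i n, Q.τ (π (i, n)) = π (i - 1, n)
  arrows_right : ∀ i n, Q.arrows (π (i, n)) (π (i, n + 1)) = 1
  arrows_left : ∀ i n, Q.arrows (π (i - 1, n + 1)) (π (i, n)) = 1
  pred : ∀ {i n c}, c ∈ K → Q.arrows c (π (i, n)) ≠ 0 →
    c = π (i - 1, n + 1) ∨ ∃ m, n = m + 1 ∧ c = π (i, m)

lemma HasTreeClassAInfinity.exists_cover {Q : TranslationQuiver.{u}} {K : Set Q.V}
    (h : Q.HasTreeClassAInfinity K) : ∃ π, Q.IsZAInfinityCover K π := by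
  obtain ⟨G, ⟨hG, -, -⟩, (π : ℤ × ℕ → Q.V), (hK : Set.range π = K),
    (hπ : ∀ p q : ℤ × ℕ, π p = π q ↔ ∃ g ∈ G, g p = q),
    (hτ : ∀ p : ℤ × ℕ, π (p.1 - 1, p.2) = Q.τ (π p)),
    (harr : ∀ p q : ℤ × ℕ, zAInfinity.arrows p q ≠ 0 →
      Q.arrows (π p) (π q) = zAInfinity.arrows p q),
    (hlift : ∀ p : ℤ × ℕ, ∀ c ∈ K, Q.arrows (π p) c ≠ 0 →
      ∃ q : ℤ × ℕ, zAInfinity.arrows p q ≠ 0 ∧ π q = c)⟩ := h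
  simp only [zAInfinity_arrows_ne_zero] at harr hlift
  have hadj : ∀ g : Equiv.Perm (ℤ × ℕ), g ∈ G →
      ∀ p q, ZAInfinityAdj (g p) (g q) ↔ ZAInfinityAdj p q := fun g hg p q => by
    rw [← zAInfinity_arrows_ne_zero, ← zAInfinity_arrows_ne_zero]
    exact iff_of_eq (congrArg (· ≠ 0) ((hG g hg).1 p q))
  have one : ∀ {p q : ℤ × ℕ}, ZAInfinityAdj p q → Q.arrows (π p) (π q) = 1 :=
    fun hpq => (harr _ _ hpq).trans (zAInfinity_arrows_eq_one hpq)
  refine ⟨π, ⟨fun c => by rw [← hK]; rfl, fun {p q} hpq => ?_, fun i n => (hτ _).symm,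
    fun i n => one (Or.inl ⟨rfl, rfl⟩), fun i n => one (Or.inr ⟨by simp, rfl⟩), ?_⟩⟩
  · obtain ⟨g, hg, rfl⟩ := (hπ _ _).1 hpq
    exact (snd_apply_of_zAInfinityAdj_iff p.2 g (hadj g hg) p.1).symm
  · intro i n c hc harrow
    rw [← hK] at hc
    obtain ⟨p, rfl⟩ := hc
    obtain ⟨q, hpq, hq⟩ := hlift p _ (hK ▸ ⟨_, rfl⟩) harrow
    -- The covering property lifts arrows with a given starting point; a deck transformation moves
    -- the lifted arrow so that it ends at `(i, n)`.
    obtain ⟨g, hg, hgq⟩ := (hπ _ _).1 hq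
    obtain ⟨⟨j, m⟩, hp⟩ : ∃ p' : ℤ × ℕ, g p = p' := ⟨_, rfl⟩
    have h1 : ZAInfinityAdj (j, m) (i, n) := by
      have := (hadj g hg p q).2 hpq
      rwa [← hp, ← hgq]
    rw [(hπ p (j, m)).2 ⟨g, hg, hp⟩]
    rcases h1 with ⟨h3, h4⟩ | ⟨h3, h4⟩ <;> dsimp only at h3 h4
    · subst h3 h4
      exact Or.inr ⟨m, rfl, rfl⟩
    · subst h3 h4
      exact Or.inl (by simp)

/-- Together with the orbit hypothesis, this shows that `Σ^(r-d)` preserves levels. -/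
lemma IsZAInfinityCover.snd_eq_of_sameCycle {Q : TranslationQuiver.{u}} {K : Set Q.V}
    {π : ℤ × ℕ → Q.V} (h : Q.IsZAInfinityCover K π) {c : Q.V} {p : ℤ × ℕ}
    (hc : Q.τ.SameCycle c (π p)) : ∃ i, c = π (i, p.2) := by
  have hpow : ∀ m : ℤ, ∃ i, (Q.τ ^ m) (π p) = π (i, p.2) := fun m => by
    induction m with
    | zero => exact ⟨p.1, rfl⟩
    | succ m ih =>
      obtain ⟨i, hi⟩ := ih
      exact ⟨i - 1, by rw [add_comm, zpow_one_add, Equiv.Perm.mul_apply, hi, h.map_τ]⟩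
    | pred m ih =>
      obtain ⟨i, hi⟩ := ih
      refine ⟨i + 1, ?_⟩
      rw [sub_eq_neg_add, zpow_add, Equiv.Perm.mul_apply, hi, zpow_neg_one,
        Equiv.Perm.inv_eq_iff_eq, h.map_τ, add_sub_cancel_right]
  obtain ⟨m, hm⟩ := hc.symm
  rw [← hm]
  exact hpow m

end TranslationQuiver

/-! ### Isomorphism classes and supports. -/

section Support

variable {k : Type w} [Field k] {C : Type u} [Category.{v} C] [Preadditive C] [Linear k C]

/-- As the space of irreducible morphisms is one-dimensional, `c` is a scalar multiple of `φ.hom ≫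
b` modulo the square of the radical. -/
lemma exists_sub_comp_mem_homRadSq {Y B W : C} (φ : Y ≅ B) {b : B ⟶ W} (hb : b ∈ homRad k B W)
    (hb' : b ∉ homRadSq k B W) (h : irrDim k B W = 1) {c : Y ⟶ W} (hc : c ∈ homRad k Y W) :
    ∃ v : Y ⟶ B, c - v ≫ b ∈ homRadSq k Y W := by
  obtain ⟨l, hl⟩ := exists_sub_smul_mem_homRadSq (a := φ.hom ≫ b)
    ((irrDim_congr φ (Iso.refl W)).trans h) (homRad_comp_left hb _)
    (fun h' => hb' (by simpa using homRadSq_comp_left h' φ.inv)) hc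
  exact ⟨l • φ.hom, by simpa using hl⟩

variable [HasBinaryBiproducts C]

lemma IndecClass.mk_eq_mk_iff {X Y : C} {hX : Indecomposable X} {hY : Indecomposable Y} :
    IndecClass.mk X hX = IndecClass.mk Y hY ↔ Nonempty (X ≅ Y) :=
  Quotient.eq (r := indecSetoid C)

lemma IndecClass.exists_mk_eq (c : IndecClass C) : ∃ X hX, IndecClass.mk X hX = c := by
  obtain ⟨⟨X, hX⟩, h⟩ := Quotient.exists_rep c
  exact ⟨X, hX, h⟩

lemma mem_homSupport_iff {X Y : C} {f : X ⟶ Y} {c : IndecClass C} : c ∈ homSupport k f ↔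
    ∃ (V : C) (hV : Indecomposable V), IndecClass.mk V hV = c ∧ ∃ g : V ⟶ X, g ≫ f ≠ 0 := by
  have key : ∀ V : C, ((linearYoneda k C).map f).app (Opposite.op V) ≠ 0 ↔
      ∃ g : V ⟶ X, g ≫ f ≠ 0 := fun V => by
    rw [← not_iff_not]
    push Not
    constructor
    · intro h g
      exact congrArg (fun t => t.hom g) h
    · intro h
      ext g
      exact h g
  simp only [homSupport, Set.mem_ofPred_eq, key]

end Support

/-! ### Climbing the levels of the component. -/

section Component

variable {k : Type w} [Field k] {C : Type u} [Category.{v} C] [Preadditive C] [Linear k C]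
  [HasZeroObject C] [HasShift C ℤ] [∀ n : ℤ, (shiftFunctor C n).Additive]
  [Pretriangulated C]

lemma IsKrullSchmidt.mk_eq_mk_of_notMem_homRad (hC : IsKrullSchmidt C) {X Y : C}
    (hX : Indecomposable X) (hY : Indecomposable Y) {f : X ⟶ Y} (hf : f ∉ homRad k X Y) :
    IndecClass.mk X hX = IndecClass.mk Y hY :=
  IndecClass.mk_eq_mk_iff.2 (hC.nonempty_iso_of_notMem_homRad hX hY hf)

/-- The source of `a` is the predecessor of level `n - 1` of the vertex `(i, n)`, and `a` is
irreducible; for `n = 0` the source of `a` is zero. -/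
def IsLevelRaising (k : Type w) [Field k] [Linear k C] (π : ℤ × ℕ → IndecClass C) (i : ℤ) (n : ℕ)
    {A W : C} (a : A ⟶ W) : Prop :=
  (n = 0 ∧ IsZero A) ∨
    (a ∉ homRadSq k A W ∧ ∃ (m : ℕ) (hA : Indecomposable A), n = m + 1 ∧
      IndecClass.mk A hA = π (i, m))

variable [∀ X Y : C, Module.Finite k (X ⟶ Y)] {d : ℤ} {K : Set (IndecClass C)}
  {π : ℤ × ℕ → IndecClass C}

/-- The inductive step of the climb: the morphism `b₁` into `B` is again level raising, so the lemma
applies next to `B` and `b₁`. -/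
lemma exists_mesh (hC : IsKrullSchmidt C) (hd : IsCalabiYau k C d)
    (hK : ∀ {c c'}, c' ∈ K → (arQuiver k (shiftFunctor C d)).arrows c c' ≠ 0 → c ∈ K)
    (hπ : (arQuiver k (shiftFunctor C d)).IsZAInfinityCover K π) {i : ℤ} {n : ℕ} {W : C}
    {hW : Indecomposable W} (hWπ : IndecClass.mk W hW = π (i, n)) {A : C} {a : A ⟶ W}
    (ha : a ∈ homRad k A W) (ha' : IsLevelRaising k π i n a) :
    ∃ (B : C) (hB : Indecomposable B) (b : B ⟶ W), IndecClass.mk B hB = π (i - 1, n + 1) ∧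
      (∀ (Y : C) (c : Y ⟶ W), c ∈ homRad k Y W → ∃ u v, c = u ≫ a + v ≫ b) ∧
      ∃ (X : C) (a₁ : X ⟶ A) (b₁ : X ⟶ B), a₁ ≫ a + b₁ ≫ b = 0 ∧ b₁ ∈ homRad k X B ∧
        IsLevelRaising k π (i - 1) (n + 1) b₁ := by
  have hWK : IndecClass.mk W hW ∈ K := hWπ ▸ (hπ.mem_iff _).2 ⟨_, rfl⟩
  obtain ⟨B, hB, hBπ⟩ := IndecClass.exists_mk_eq (π (i - 1, n + 1))
  have hBW : irrDim k B W = 1 := by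
    have h := hπ.arrows_left i n
    rwa [← hBπ, ← hWπ] at h
  obtain ⟨b, hb, hb'⟩ := exists_mem_homRad_notMem_homRadSq (k := k) (X := B) (Y := W)
    (by rw [hBW]; exact one_ne_zero)
  obtain ⟨E, x, e, hxe⟩ := IsSerreFunctor.exists_isAlmostSplit hC hd hW
  -- If `A` is nonzero, `B` is two levels above it, so the two are not isomorphic.
  have hBA : ∀ g : B ⟶ A, g ∈ homRad k B A := fun g => by
    rcases ha' with ⟨-, hA⟩ | ⟨-, m, hA, rfl, hAπ⟩
    · rw [hA.eq_of_tgt g 0]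
      exact zero_mem _
    · by_contra hg
      have := (hC.mk_eq_mk_of_notMem_homRad hB hA hg)
      rw [hBπ, hAπ] at this
      have := hπ.level this
      dsimp only at this
      omega
  have he : e ∈ factorsModRadSq k a b E := by
    refine hC.induction_sources (factorsModRadSq k a b)
      (fun g _ hc => comp_mem_factorsModRadSq g hc) (fun Y hY c hc => ?_) hxe.mem_homRad
    rw [mem_factorsModRadSq]
    by_cases h0 : irrDim k Y W = 0
    · exact ⟨0, 0, c, homRad_le_homRadSq h0 hc, by simp⟩
    · have h1 : (arQuiver k (shiftFunctor C d)).arrows (IndecClass.mk Y hY) (π (i, n)) ≠ 0 := by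
        rw [← hWπ]
        exact h0
      rcases hπ.pred (hK hWK (hWπ ▸ h1)) h1 with h | ⟨m, rfl, h⟩
      · obtain ⟨φ⟩ := IndecClass.mk_eq_mk_iff.1 (h.trans hBπ.symm)
        obtain ⟨v, hv⟩ := exists_sub_comp_mem_homRadSq φ hb hb' hBW hc
        exact ⟨0, v, _, hv, by simp⟩
      · rcases ha' with ⟨h0, -⟩ | ⟨ha', m', hA, hm, hAπ⟩
        · exact absurd h0 (Nat.succ_ne_zero m)
        · obtain rfl : m = m' := by omega
          have hAW : irrDim k A W = 1 := by
            have h := hπ.arrows_right i m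
            rwa [← hAπ, ← hWπ] at h
          obtain ⟨φ⟩ := IndecClass.mk_eq_mk_iff.1 (h.trans hAπ.symm)
          obtain ⟨v, hv⟩ := exists_sub_comp_mem_homRadSq φ ha ha' hAW hc
          exact ⟨v, 0, _, hv, by simp⟩
  obtain ⟨hfac, a₁, b₁, hab, hb₁⟩ := hxe.exists_mesh ha hb hb' hBA he
  have := hd.1
  let F := shiftFunctor C d ⋙ shiftFunctor C (-1 : ℤ)
  have : F.asEquivalence.functor.Additive := inferInstanceAs F.Additive
  have hX : Indecomposable (F.obj W) := indecomposable_map_equivalence hW F.asEquivalence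
  have hXπ : IndecClass.mk (F.obj W) hX = π (i - 1, n) := by
    rw [← hπ.map_τ, ← hWπ]
    rfl
  refine ⟨B, hB, b, hBπ, hfac, _, a₁, b₁, hab, ?_, Or.inr ⟨hb₁, n, hX, rfl, hXπ⟩⟩
  by_contra hg
  have h := (hC.mk_eq_mk_of_notMem_homRad hX hB hg)
  rw [hBπ, hXπ] at h
  exact absurd (hπ.level h) (Nat.succ_ne_self n).symm

variable {r : ℤ}

-- If `f` were nonzero, Serre duality would give a non-radical morphism `Σ^(r-d) U ⟶ W`, hence an
-- isomorphism, but `Σ^(r-d) U` has the level of `U`.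
omit [∀ X Y : C, Module.Finite k (X ⟶ Y)] in
lemma eq_zero_of_killsRadical (hC : IsKrullSchmidt C) (hd : IsCalabiYau k C d)
    (hπ : (arQuiver k (shiftFunctor C d)).IsZAInfinityCover K π)
    (horbit : ∀ c ∈ K, (arQuiver k (shiftFunctor C d)).τ.SameCycle
      (IndecClass.perm (shiftFunctor C (r - d)) c) c)
    {U W : C} {hU : Indecomposable U} {hW : Indecomposable W} {p q : ℤ × ℕ}
    (hUπ : IndecClass.mk U hU = π p) (hWπ : IndecClass.mk W hW = π q) (hpq : p.2 ≠ q.2)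
    {f : W ⟶ U⟦r⟧} (hf : KillsRadical k f) : f = 0 := by
  by_contra hf₀
  let s := (shiftFunctorAdd' C (r - d) d r (by simp)).app U
  obtain ⟨g, hg⟩ := IsSerreFunctor.exists_notMem_homRad hd (hf.comp s.hom)
    (by rwa [Ne, Preadditive.IsIso.comp_right_eq_zero])
  let F := shiftFunctor C (r - d)
  have : F.asEquivalence.functor.Additive := inferInstanceAs F.Additive
  have hU' : Indecomposable (F.obj U) := indecomposable_map_equivalence hU F.asEquivalence
  have h := horbit (IndecClass.mk U hU) ((hπ.mem_iff _).2 ⟨p, hUπ.symm⟩)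
  rw [hUπ] at h
  obtain ⟨i, hi⟩ := hπ.snd_eq_of_sameCycle h
  have h1 : IndecClass.mk (F.obj U) hU' = π (i, p.2) := by
    rw [← hi, ← hUπ]
    rfl
  have h2 := (hC.mk_eq_mk_of_notMem_homRad hU' hW hg)
  rw [h1, hWπ] at h2
  exact hpq (hπ.level (p := (i, p.2)) h2)

-- By naturality the composite is `α_A ≫ Σ^r a`, and `Σ^r a` is `S` of the radical morphism `Σ^(r-d)
-- a`.
omit [HasZeroObject C] [Pretriangulated C] [∀ X Y : C, Module.Finite k (X ⟶ Y)] in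
lemma comp_app_eq_zero (hd : IsCalabiYau k C d) (α : 𝟭 C ⟶ shiftFunctor C r) {A U : C}
    (hα : KillsRadical k (α.app A)) {a : A ⟶ U} (ha : a ∈ homRad k A U) : a ≫ α.app U = 0 := by
  let s := shiftFunctorAdd' C (r - d) d r (by simp)
  have h := IsSerreFunctor.comp_map_eq_zero hd (hα.comp (s.hom.app A))
    (homRad_map (shiftFunctor C (r - d)) ha)
  have h1 : a ≫ α.app U = α.app A ≫ a⟦r⟧' := α.naturality a
  rw [h1, ← cancel_mono (s.hom.app U), zero_comp, Category.assoc, s.hom.naturality,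
    ← Category.assoc]
  exact h

open ZeroObject in
/-- On a component of tree class `A_∞` a natural transformation `Id ⟶ Σ ^ r` with finite supports
vanishes on radical morphisms. -/
lemma killsRadical_app (hC : IsKrullSchmidt C) (hd : IsCalabiYau k C d)
    (hK : ∀ {c c'}, c' ∈ K → (arQuiver k (shiftFunctor C d)).arrows c c' ≠ 0 → c ∈ K)
    (hπ : (arQuiver k (shiftFunctor C d)).IsZAInfinityCover K π)
    (horbit : ∀ c ∈ K, (arQuiver k (shiftFunctor C d)).τ.SameCycle
      (IndecClass.perm (shiftFunctor C (r - d)) c) c)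
    (α : 𝟭 C ⟶ shiftFunctor C r)
    (hfin : ∀ (U : C) (hU : Indecomposable U), IndecClass.mk U hU ∈ K →
      (homSupport k (α.app U)).Finite) (n : ℕ) :
    ∀ (i : ℤ) (U : C) (hU : Indecomposable U), IndecClass.mk U hU = π (i, n) →
      KillsRadical k (α.app U) := by
  have hchain : ∀ (n : ℕ) (i : ℤ) (U : C) (hU : Indecomposable U), IndecClass.mk U hU = π (i, n) →
      ∀ (A : C) (a : A ⟶ U), a ∈ homRad k A U → IsLevelRaising k π i n a →
      a ≫ α.app U = 0 → KillsRadical k (α.app U) := by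
    intro n i U hU hUπ A a ha ha' haα
    by_contra hrad
    have hne : ∀ {W B A : C} {b : B ⟶ W} {a : A ⟶ W} {f : W ⟶ U⟦r⟧},
        (∀ (Y : C) (c : Y ⟶ W), c ∈ homRad k Y W → ∃ u v, c = u ≫ a + v ≫ b) →
        a ≫ f = 0 → ¬ KillsRadical k f → b ≫ f ≠ 0 := by
      intro W B A b a f hfac haf hf hbf
      refine hf fun Y c hc => ?_
      obtain ⟨u, v, rfl⟩ := hfac Y c hc
      simp [haf, hbf]
    -- The objects `W` follow the infinite path `⋯ → (i - 2, n + 2) → (i - 1, n + 1) → (i, n)`. The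
    -- vanishing on `a` is carried along so that the next mesh can be used.
    have key : ∀ j : ℕ, ∃ (W : C) (hW : Indecomposable W) (g : W ⟶ U) (A : C) (a : A ⟶ W),
        IndecClass.mk W hW = π (i - 1 - j, n + 1 + j) ∧ g ≫ α.app U ≠ 0 ∧ a ∈ homRad k A W ∧
        IsLevelRaising k π (i - 1 - j) (n + 1 + j) a ∧ a ≫ g ≫ α.app U = 0 := by
      intro j
      induction j with
      | zero =>
        obtain ⟨B, hB, b, hBπ, hfac, X, a₁, b₁, hab, hb₁, hb₁'⟩ :=
          exists_mesh hC hd hK hπ hUπ ha ha'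
        refine ⟨B, hB, b, X, b₁, by simpa using hBπ, hne hfac haα hrad, hb₁,
          by simpa using hb₁', ?_⟩
        rw [← Category.assoc, eq_neg_of_add_eq_zero_right hab, Preadditive.neg_comp,
          Category.assoc]
        exact (congrArg (fun t => -(a₁ ≫ t)) haα).trans (by simp)
      | succ j ih =>
        obtain ⟨W, hW, g, A, a, hWπ, hg, ha, ha', hag⟩ := ih
        obtain ⟨B, hB, b, hBπ, hfac, X, a₁, b₁, hab, hb₁, hb₁'⟩ :=
          exists_mesh hC hd hK hπ hWπ ha ha'
        have hj : i - 1 - (j : ℤ) - 1 = i - 1 - ((j + 1 : ℕ) : ℤ) := by push_cast; ring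
        rw [hj] at hBπ hb₁'
        refine ⟨B, hB, b ≫ g, X, b₁, hBπ, ?_, hb₁, hb₁', ?_⟩
        · rw [Category.assoc]
          -- Here `W` lies strictly above the level of `U`, so the nonzero `g ≫ α.app U` cannot kill
          -- the radical.
          exact hne hfac hag fun h => hg
            (eq_zero_of_killsRadical hC hd hπ horbit hUπ hWπ (by simp; omega) h)
        · rw [Category.assoc, ← Category.assoc b₁, eq_neg_of_add_eq_zero_right hab,
            Preadditive.neg_comp, Category.assoc, hag, comp_zero, neg_zero]
    refine Set.infinite_of_injective_forall_mem
      (f := fun j : ℕ => π (i - 1 - j, n + 1 + j)) (fun j j' h => ?_) (fun j => ?_)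
      (hfin U hU ((hπ.mem_iff _).2 ⟨_, hUπ.symm⟩))
    · have := hπ.level h
      dsimp only at this
      omega
    · obtain ⟨W, hW, g, -, -, hWπ, hg, -⟩ := key j
      exact mem_homSupport_iff.2 ⟨W, hW, hWπ, g, hg⟩
  induction n with
  | zero =>
    intro i U hU hUπ
    -- On the boundary level there is no lower neighbour, and the zero object takes its place.
    exact hchain _ i U hU hUπ 0 0 (zero_mem _) (Or.inl ⟨rfl, isZero_zero C⟩) zero_comp
  | succ n ih =>
    intro i U hU hUπ
    obtain ⟨A, hA, hAπ⟩ := IndecClass.exists_mk_eq (π (i, n))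
    have hAU : irrDim k A U = 1 := by
      have h := hπ.arrows_right i n
      rwa [← hAπ, ← hUπ] at h
    obtain ⟨a, ha, ha'⟩ := exists_mem_homRad_notMem_homRadSq (k := k) (X := A) (Y := U)
      (by rw [hAU]; exact one_ne_zero)
    exact hchain _ i U hU hUπ A a ha (Or.inr ⟨ha', n, hA, rfl, hAπ⟩)
      (comp_app_eq_zero hd α (ih i A hA hAπ) ha)

end Component

/-! ### The main theorem. -/

theorem mainTheorem6
    {k : Type w} [Field k] [IsAlgClosed k]
    {C : Type u} [Category.{v} C] [Preadditive C] [Linear k C] [HasZeroObject C]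
    [HasShift C ℤ] [∀ n : ℤ, (shiftFunctor C n).Additive]
    [∀ n : ℤ, (shiftFunctor C n).Linear k]
    [Pretriangulated C] [IsTriangulated C]
    (homFinite : ∀ X Y : C, Module.Finite k (X ⟶ Y))
    (krullSchmidt : IsKrullSchmidt C)
    (r d : ℤ) (N : C) (hN : Indecomposable N)
    (calabiYau : IsCalabiYau k C d)
    (K : Set (IndecClass C))
    (hK : K = (arQuiver k (shiftFunctor C d)).component (IndecClass.mk N hN))
    (sameOrbit : ∀ c ∈ K, (arQuiver k (shiftFunctor C d)).τ.SameCycle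
      (IndecClass.perm (shiftFunctor C (r - d)) c) c)
    (meshes : MeshesHaveAtMostTwoMiddleTerms K)
    (treeClass : (arQuiver k (shiftFunctor C d)).HasTreeClassAInfinity K) :
    ¬ ∃ α : 𝟭 C ⟶ shiftFunctor C r, InGradedCenter α ∧
      (∀ (U : C) (hU : Indecomposable U), IndecClass.mk U hU ∈ K →
        (homSupport k (α.app U)).Finite) ∧
      (∃ (U : C) (hU : Indecomposable U), IndecClass.mk U hU ∈ K ∧
        2 ≤ (homSupport k (α.app U)).encard) := by
  rintro ⟨α, -, hfin, U, hU, hUK, hcard⟩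
  have hK' : ∀ {c c'}, c' ∈ K → (arQuiver k (shiftFunctor C d)).arrows c c' ≠ 0 → c ∈ K := by
    intro c c' hc' h
    rw [hK] at hc' ⊢
    exact Relation.EqvGen.trans _ _ _ hc' (Relation.EqvGen.symm _ _ (Relation.EqvGen.rel _ _ h))
  obtain ⟨π, hπ⟩ := treeClass.exists_cover
  obtain ⟨⟨i, n⟩, hp⟩ := (hπ.mem_iff _).1 hUK
  have hkill := killsRadical_app krullSchmidt calabiYau hK' hπ sameOrbit α hfin n i U hU hp.symm
  have hsub : homSupport k (α.app U) ⊆ {IndecClass.mk U hU} := by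
    intro c hc
    obtain ⟨V, hV, rfl, g, hg⟩ := mem_homSupport_iff.1 hc
    exact krullSchmidt.mk_eq_mk_of_notMem_homRad (k := k) hV hU (f := g)
      fun hrad => hg (hkill V g hrad)
  have := hcard.trans (Set.encard_le_encard hsub)
  rw [Set.encard_singleton] at this
  exact absurd this (by decide)
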